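/- Let $d,n\ge 1$ and $N\ge 2$. Let $P_{\mathbf x}$ be a probability distribution on $\mathbb R^d$ that has a density with respect to Lebesgue measure, let $w_*\in\mathbb R^d\setminus\{0\}$ (the teacher), let $x_1,\dots,x_n$ be sampled i.i.d. from $P_{\mathbf x}$, put $X=[x_1,\dots,x_n]\in\mathbb R^{d\times n}$ and $y_i=\sigma(w_*^\top x_i)$ with $\sigma(u)=1/(1+e^{-u})$. Let $$L^1(w)=-\frac1n\sum_{i=1}^n\Big[y_i\log\sigma(w^\top x_i)+(1-y_i)\log\big(1-\sigma(w^\top x_i)\big)\Big]-L^*,$$ where the constant $L^*$ is such that the minimum of $L^1$ over $\mathbb R^d$ is $0$. The student is a deep linear network with $N$ layers: weight matrices $W_i\in\mathbb R^{k_i\times k_{i-1}}$, $i=1,\dots,N$, with $k_0=d$, $k_N=1$ and arbitrary hidden widths $k_1,\dots,k_{N-1}$. It is trained by gradient flow on $L(W_1,\dots,W_N)=L^1((W_N\cdots W_1)^\top)$, that is, for $\tau\in[0,\infty)$ and $i=1,\dots,N$, $$\frac{\partial W_i(\tau)}{\partial\tau}=-\frac{\partial L}{\partial W_i}\big(W_1(\tau),\dots,W_N(\tau)\big),\qquad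 w(\tau)^\top:=W_N(\tau)\cdots W_1(\tau).$$ Let $$\hat w=\begin{cases}w_*, & n\ge d,\\ X(X^\top X)^{-1}X^\top w_*, & n<d.\end{cases}$$ Assume that for some $\epsilon>0$ the initialisation satisfies $$\|w(0)\|<\min\Big\{\|\hat w\|,\ \epsilon^N\Big(\epsilon^2\|\hat w\|^{-2/N}+\|\hat w\|^{2-2/N}\Big)^{-N/2}\Big\},\qquad L^1(w(0))<L^1(0),$$ $$W_{j+1}(0)^\top W_{j+1}(0)=W_j(0)W_j(0)^\top\quad\text{for } j=1,\dots,N-1,$$ where $\|\cdot\|$ is the Euclidean norm. If $n\ge d$, then almost surely with respect to $x_1,\dots,x_n$ (with an exceptional null set that depends neither on $\epsilon$ nor on the initialisation) $w(t)\to\hat w$ as $t\to\infty$. If $n<d$, then $X^\top X$ is almost surely invertible, and whenever it is invertible, $\|w(t)-\hat w\|\le\epsilon$ for all sufficiently large $t$. -/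

import Mathlib

open MeasureTheory Filter Topology
open scoped Matrix ENNReal

namespace LinearDistillation

noncomputable section

/-- The input space `ℝ^d` with the Euclidean norm. -/
abbrev Vec (d : ℕ) : Type := EuclideanSpace ℝ (Fin d)

/-- The data matrix `X = [x₁, …, xₙ] ∈ ℝ^{d × n}`, whose columns are the inputs. -/
def dataMatrix {d n : ℕ} (x : Fin n → Vec d) : Matrix (Fin d) (Fin n) ℝ :=
  Matrix.of fun i j => x j i

/-- The soft label `yᵢ = σ(w⋆ᵀ xᵢ)` provided by the teacher `w⋆`. -/
def softLabel {d n : ℕ} (wstar : Vec d) (x : Fin n → Vec d) (i : Fin n) : ℝ :=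
  Real.sigmoid (inner ℝ wstar (x i))

/-- The cross-entropy loss, before normalization. -/
def crossEntropy {d n : ℕ} (wstar : Vec d) (x : Fin n → Vec d) (w : Vec d) : ℝ :=
  -(1 / (n : ℝ)) * ∑ i : Fin n,
    (softLabel wstar x i * Real.log (Real.sigmoid (inner ℝ w (x i)))
      + (1 - softLabel wstar x i) * Real.log (1 - Real.sigmoid (inner ℝ w (x i))))

/-- The normalized cross-entropy loss `L¹(w)`: the constant `L⋆` that is subtracted is the
minimum of the cross-entropy, so that the minimum of `L¹` is `0`. -/
def loss {d n : ℕ} (wstar : Vec d) (x : Fin n → Vec d) (w : Vec d) : ℝ :=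
  crossEntropy wstar x w - ⨅ v : Vec d, crossEntropy wstar x v

/-- The vector `ŵ`: it is `w⋆` if `n ≥ d`, and `X (Xᵀ X)⁻¹ Xᵀ w⋆` if `n < d`. -/
def wHat {d n : ℕ} (wstar : Vec d) (x : Fin n → Vec d) : Vec d :=
  if d ≤ n then wstar
  else WithLp.toLp 2 ((dataMatrix x * ((dataMatrix x)ᵀ * dataMatrix x)⁻¹ * (dataMatrix x)ᵀ)
    *ᵥ wstar.ofLp)

/-- The layer widths of a linear network with `N` layers, `d` inputs and one output. The hidden
widths `width 1, …, width (N - 1)` are arbitrary, and the values beyond `N` are not used. -/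
structure Architecture (d N : ℕ) where
  width : ℕ → ℕ
  width_zero : width 0 = d
  width_last : width N = 1

/-- The weight matrices. Layers are numbered from `0`: `W i` is the matrix `W_{i+1}`, of size
`width (i + 1) × width i`. -/
abbrev Weights {d N : ℕ} (A : Architecture d N) : Type :=
  (i : Fin N) → Matrix (Fin (A.width (i.val + 1))) (Fin (A.width i.val)) ℝ

/-- The partial product `W_k W_{k-1} ⋯ W_1` of the first `k` weight matrices. -/
def partialProd {d N : ℕ} {A : Architecture d N} (W : Weights A) :
    (k : ℕ) → k ≤ N → Matrix (Fin (A.width k)) (Fin (A.width 0)) ℝ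
  | 0, _ => 1
  | k + 1, h => W ⟨k, h⟩ * partialProd W k (Nat.le_of_succ_le h)

/-- The end-to-end weight vector `w`, where `wᵀ = W_N W_{N-1} ⋯ W_1`. -/
def endToEnd {d N : ℕ} {A : Architecture d N} (W : Weights A) : Vec d :=
  WithLp.toLp 2 fun j =>
    partialProd W N le_rfl (Fin.cast A.width_last.symm 0) (Fin.cast A.width_zero.symm j)

/-- The loss as a function of the weight matrices, `L(W_1, …, W_N) = L¹((W_N ⋯ W_1)ᵀ)`. -/
def deepLoss {d n N : ℕ} {A : Architecture d N} (wstar : Vec d) (x : Fin n → Vec d)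
    (W : Weights A) : ℝ :=
  loss wstar x (endToEnd W)

/-- The partial derivative `∂F/∂(W_{i+1})`: the matrix of the partial derivatives of `F` with
respect to the entries of that weight matrix. -/
def partialGrad {d N : ℕ} {A : Architecture d N} (F : Weights A → ℝ) (W : Weights A)
    (i : Fin N) : Matrix (Fin (A.width (i.val + 1))) (Fin (A.width i.val)) ℝ :=
  Matrix.of fun a b =>
    deriv (fun s : ℝ => F (Function.update W i (W i + s • Matrix.single a b (1 : ℝ)))) 0

/-- `W` is a solution on `[0, ∞)` of the gradient flow `dWᵢ/dτ = -∂L/∂Wᵢ`, `i = 1, …, N`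
(with the one-sided derivative at `τ = 0`). -/
def IsGradientFlow {d n N : ℕ} {A : Architecture d N} (wstar : Vec d) (x : Fin n → Vec d)
    (W : ℝ → Weights A) : Prop :=
  ∀ τ : ℝ, 0 ≤ τ → ∀ (i : Fin N) (a : Fin (A.width (i.val + 1))) (b : Fin (A.width i.val)),
    HasDerivWithinAt (fun s : ℝ => W s i a b)
      (-(partialGrad (deepLoss wstar x) (W τ) i a b)) (Set.Ici 0) τ

/-- Balancedness: `W_{j+1}ᵀ W_{j+1} = W_j W_jᵀ` for `j = 1, …, N - 1`. -/
def Balanced {d N : ℕ} {A : Architecture d N} (W : Weights A) : Prop :=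
  ∀ (j : ℕ) (h : j + 1 < N),
    (W ⟨j + 1, h⟩)ᵀ * W ⟨j + 1, h⟩ = W ⟨j, Nat.lt_of_succ_lt h⟩ * (W ⟨j, Nat.lt_of_succ_lt h⟩)ᵀ

/-- The conditions on the initial weights, for the accuracy `ε`: small end-to-end norm, a loss
better than that of the zero vector, and balancedness. -/
structure GoodInit {d n N : ℕ} {A : Architecture d N} (wstar : Vec d) (x : Fin n → Vec d)
    (ε : ℝ) (W₀ : Weights A) : Prop where
  near_zero : ‖endToEnd W₀‖ <
    min ‖wHat wstar x‖
      (ε ^ N * (ε ^ 2 * ‖wHat wstar x‖ ^ (-(2 / (N : ℝ)))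
        + ‖wHat wstar x‖ ^ (2 - 2 / (N : ℝ))) ^ (-((N : ℝ) / 2)))
  better_than_zero : loss wstar x (endToEnd W₀) < loss wstar x 0
  balanced : Balanced W₀

end

end LinearDistillation

/-!
The end-to-end vector `w` of a balanced deep linear network with one output follows a closed
equation. Gradient flow conserves balancedness, and balancedness makes the Gram matrices of all
layers equal to `s` times a projection, where `s` is the squared norm of the last layer. Hence
`s ^ N = ‖w‖²`, and with the gradient `g` of the loss at `w`,
`s' = -2 ⟪w, g⟫` and `s w' = -(s ^ N g + (N - 1) ⟪w, g⟫ w)` (`endToEnd_dynamics`).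

The loss therefore decreases at a rate of at least `s ^ (N - 1) ‖g‖²`. Since it starts below its
value at `0`, the vector `w` stays away from `0`, so this rate is bounded below by a multiple of
`‖g‖²`. The loss depends only on the orthogonal projection `v` of `w` to the span of the data. On
this span it is coercive, because the labels lie strictly between `0` and `1`, and its only critical
point is the projection of the teacher, because `σ` is strictly monotone. By compactness `v`
converges to that point (`EndToEndFlow.tendsto_starProjection`). If `n ≥ d`, the inputs almost
surely span the whole space, because proper subspaces have measure zero
(`ae_linearIndependent_or_span_eq_top`), and this is the first claim.

If `n < d`, then almost surely the inputs are linearly independent, and `ŵ` is the projection of the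
teacher. Let `q = w - v`. As `g` lies in the span of the data, the equations above show that
`C = ‖q‖² / s ^ (N - 1)` is constant, and `C ≤ s(0) = ‖w(0)‖ ^ (2 / N)`. Together with
`s ^ N = ‖v‖² + ‖q‖²` this gives `‖q‖² (s - C) = C ‖v‖²`, where `s ≥ ‖v‖ ^ (2 / N)`. So the limit
superior of `‖q‖²` is at most `C a² / (a ^ (2 / N) - C)` with `a = ‖ŵ‖`, and the bound on `‖w(0)‖`
says exactly that this is less than `ε²` when `C` is replaced by `‖w(0)‖ ^ (2 / N)`
(`EndToEndFlow.eventually_norm_sub_le`).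
-/

namespace LinearDistillation

/-! ### Products of consecutive layers -/

section Segments

variable {width : ℕ → ℕ}

/-- The product `V (k - 1) * ⋯ * V i` of consecutive layers, for `i ≤ k`; it is the identity for
`i = k`. For `i > k` the value is irrelevant. The identity is written through the values of
the indices, because `i` and `k` are not syntactically equal in the definition. -/
noncomputable def seg (V : (i : ℕ) → Matrix (Fin (width (i + 1))) (Fin (width i)) ℝ) (i : ℕ) :
    (k : ℕ) → Matrix (Fin (width k)) (Fin (width i)) ℝ
  | 0 => Matrix.of fun a b => if a.val = b.val then 1 else 0
  | k + 1 => if i ≤ k then V k * seg V i k else Matrix.of fun a b => if a.val = b.val then 1 else 0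

variable (V : (i : ℕ) → Matrix (Fin (width (i + 1))) (Fin (width i)) ℝ)

lemma seg_self (i : ℕ) : seg V i i = 1 := by
  cases i <;> ext a b <;> simp [seg, Matrix.one_apply, Fin.ext_iff]

lemma seg_succ {i k : ℕ} (h : i ≤ k) : seg V i (k + 1) = V k * seg V i k := by
  rw [seg, if_pos h]

lemma seg_eq_mul_left {i k : ℕ} (h : i + 1 ≤ k) : seg V i k = seg V (i + 1) k * V i := by
  induction k, h using Nat.le_induction with
  | base => rw [seg_succ V le_rfl, seg_self, seg_self, Matrix.one_mul, Matrix.mul_one]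
  | succ k h ih => rw [seg_succ V (by omega), seg_succ V h, ih, Matrix.mul_assoc]

lemma seg_congr {V V' : (i : ℕ) → Matrix (Fin (width (i + 1))) (Fin (width i)) ℝ} {i k : ℕ}
    (hik : i ≤ k) (h : ∀ j, i ≤ j → j < k → V j = V' j) : seg V i k = seg V' i k := by
  induction k, hik using Nat.le_induction with
  | base => rw [seg_self, seg_self]
  | succ k hik ih =>
    rw [seg_succ _ hik, seg_succ _ hik, h k hik (by omega), ih fun j h1 h2 => h j h1 (by omega)]

lemma seg_mul_seg_mul {i k : ℕ} (h : i < k) : seg V (i + 1) k * V i * seg V 0 i = seg V 0 k := by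
  rw [← seg_eq_mul_left V h]
  induction k, h using Nat.le_induction with
  | base => rw [seg_succ V le_rfl, seg_self, seg_succ V (Nat.zero_le _), Matrix.mul_one]
  | succ k h ih =>
    rw [seg_succ V (by omega), seg_succ V (Nat.zero_le _), Matrix.mul_assoc, ih]

/-! ### Algebra of balanced networks -/

variable {V} {N : ℕ}

lemma balanced_gram_mul_seg
    (hV : ∀ j, j + 1 < N → (V (j + 1))ᵀ * V (j + 1) = V j * (V j)ᵀ) {k : ℕ} (hk : k < N) :
    (V k)ᵀ * V k * seg V 0 k = seg V 0 k * ((V 0)ᵀ * V 0) := by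
  induction k with
  | zero => rw [seg_self, Matrix.mul_one, Matrix.one_mul]
  | succ k ih =>
    rw [hV k hk, seg_succ V (Nat.zero_le _), Matrix.mul_assoc (V k) (seg V 0 k), ← ih (by omega)]
    simp only [Matrix.mul_assoc]

lemma balanced_seg_transpose_mul_seg
    (hV : ∀ j, j + 1 < N → (V (j + 1))ᵀ * V (j + 1) = V j * (V j)ᵀ) {k : ℕ} (hk : k ≤ N) :
    (seg V 0 k)ᵀ * seg V 0 k = ((V 0)ᵀ * V 0) ^ k := by
  induction k with
  | zero => rw [seg_self, Matrix.transpose_one, Matrix.mul_one, pow_zero]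
  | succ k ih =>
    have h := balanced_gram_mul_seg hV (k := k) (by omega)
    rw [seg_succ V (Nat.zero_le _), Matrix.transpose_mul, Matrix.mul_assoc,
      ← Matrix.mul_assoc (V k)ᵀ, h, ← Matrix.mul_assoc, ih (by omega), pow_succ]

lemma balanced_mul_seg
    (hV : ∀ j, j + 1 < N → (V (j + 1))ᵀ * V (j + 1) = V j * (V j)ᵀ) {i k : ℕ} (hik : i ≤ k)
    (hk : k < N) :
    V k * (V k)ᵀ * seg V (i + 1) (k + 1) = seg V (i + 1) (k + 1) * (V i * (V i)ᵀ) := by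
  induction k, hik using Nat.le_induction with
  | base => rw [seg_self, Matrix.mul_one, Matrix.one_mul]
  | succ k hik ih =>
    rw [seg_succ V (by omega), Matrix.mul_assoc (V (k + 1)) (seg V _ _), ← ih (by omega),
      ← hV k hk]
    simp only [Matrix.mul_assoc]

lemma balanced_seg_mul_seg_transpose {M : ℕ}
    (hV : ∀ j, j + 1 < M + 1 → (V (j + 1))ᵀ * V (j + 1) = V j * (V j)ᵀ) {i : ℕ} (hi : i ≤ M + 1) :
    seg V i (M + 1) * (seg V i (M + 1))ᵀ = (V M * (V M)ᵀ) ^ (M + 1 - i) := by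
  induction hi using Nat.decreasingInduction with
  | self => rw [seg_self, Matrix.transpose_one, Matrix.mul_one, Nat.sub_self, pow_zero]
  | of_succ i hi ih =>
    have h := balanced_mul_seg hV (i := i) (k := M) (by omega) (by omega)
    rw [seg_eq_mul_left V hi, Matrix.transpose_mul, Matrix.mul_assoc, ← Matrix.mul_assoc (V i),
      ← Matrix.mul_assoc, ← h, Matrix.mul_assoc, ih, ← pow_succ']
    congr 1
    omega

/-- If `M Mᵀ` is `s` times a projection, then so is `Mᵀ M`: the symmetric matrix
`(Mᵀ M)² - s Mᵀ M` has square zero. -/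
lemma gram_sq_of_gram_transpose_sq {m n : Type*} [Fintype m] [Fintype n] (M : Matrix m n ℝ)
    {s : ℝ} (h : (M * Mᵀ) * (M * Mᵀ) = s • (M * Mᵀ)) :
    (Mᵀ * M) * (Mᵀ * M) = s • (Mᵀ * M) := by
  set B := Mᵀ * M with hB
  have hBt : Bᵀ = B := by simp [hB]
  have h3 : B * (B * B) = s • (B * B) := by
    calc B * (B * B) = Mᵀ * ((M * Mᵀ) * (M * Mᵀ)) * M := by simp only [hB, Matrix.mul_assoc]
      _ = s • (B * B) := by rw [h]; simp [hB, Matrix.mul_assoc]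
  have h4 : (B * B - s • B)ᵀ * (B * B - s • B) = 0 := by
    have : (B * B - s • B)ᵀ = B * B - s • B := by simp [hBt]
    rw [this, Matrix.sub_mul, Matrix.mul_sub, Matrix.mul_sub, Matrix.mul_assoc B B (B * B), h3]
    simp [Matrix.mul_assoc, h3]
  have h5 : B * B - s • B = 0 := by
    rw [← Matrix.conjTranspose_eq_transpose_of_trivial] at h4
    exact Matrix.conjTranspose_mul_self_eq_zero.mp h4
  exact sub_eq_zero.mp h5

/-- In a balanced network with one output, the Gram matrix of every layer is `s` times an
orthogonal projection, where `s` is the squared norm of the last layer. -/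
lemma balanced_gram_sq {M : ℕ}
    (hV : ∀ j, j + 1 < M + 1 → (V (j + 1))ᵀ * V (j + 1) = V j * (V j)ᵀ) {s : ℝ}
    (hs : V M * (V M)ᵀ = s • 1) {j : ℕ} (hj : j ≤ M) :
    ((V j)ᵀ * V j) * ((V j)ᵀ * V j) = s • ((V j)ᵀ * V j) := by
  induction hj using Nat.decreasingInduction with
  | self => exact gram_sq_of_gram_transpose_sq _ (by rw [hs]; simp)
  | of_succ j hj ih => exact gram_sq_of_gram_transpose_sq _ (by rw [← hV j (by omega)]; exact ih)

end Segments

/-! ### Derivatives of matrix-valued curves -/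

section MatrixDerivative

/-- Entrywise derivative of a matrix-valued curve on `[0, ∞)`. -/
def MatDeriv {m n : Type*} (M : ℝ → Matrix m n ℝ) (M' : Matrix m n ℝ) (t : ℝ) : Prop :=
  ∀ a b, HasDerivWithinAt (fun τ => M τ a b) (M' a b) (Set.Ici 0) t

variable {l m n : Type*} {t : ℝ}

lemma MatDeriv.mul [Fintype m] {M : ℝ → Matrix l m ℝ} {K : ℝ → Matrix m n ℝ} {M' K'}
    (hM : MatDeriv M M' t) (hK : MatDeriv K K' t) :
    MatDeriv (fun τ => M τ * K τ) (M' * K t + M t * K') t := by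
  intro a b
  simp only [Matrix.mul_apply, Matrix.add_apply, ← Finset.sum_add_distrib]
  exact HasDerivWithinAt.fun_sum fun c _ => (hM a c).mul (hK c b)

lemma MatDeriv.transpose {M : ℝ → Matrix m n ℝ} {M'} (hM : MatDeriv M M' t) :
    MatDeriv (fun τ => (M τ)ᵀ) M'ᵀ t := fun a b => hM b a

lemma MatDeriv.sub {M K : ℝ → Matrix m n ℝ} {M' K'} (hM : MatDeriv M M' t)
    (hK : MatDeriv K K' t) : MatDeriv (fun τ => M τ - K τ) (M' - K') t :=
  fun a b => (hM a b).sub (hK a b)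

lemma eqOn_Ici_of_hasDerivWithinAt_zero {f : ℝ → ℝ}
    (h : ∀ t, 0 ≤ t → HasDerivWithinAt f 0 (Set.Ici 0) t) {t : ℝ} (ht : 0 ≤ t) : f t = f 0 :=
  constant_of_has_deriv_right_zero (a := 0) (b := t)
    (fun τ hτ => ((h τ hτ.1).continuousWithinAt).mono Set.Icc_subset_Ici_self)
    (fun τ hτ => (h τ hτ.1).mono (Set.Ici_subset_Ici.mpr hτ.1)) t ⟨ht, le_rfl⟩

lemma matDeriv_seg {width : ℕ → ℕ} {N : ℕ}
    {V : ℝ → (i : ℕ) → Matrix (Fin (width (i + 1))) (Fin (width i)) ℝ}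
    {V' : (i : ℕ) → Matrix (Fin (width (i + 1))) (Fin (width i)) ℝ}
    (h : ∀ i < N, MatDeriv (fun τ => V τ i) (V' i) t) {k : ℕ} (hk : k ≤ N) :
    MatDeriv (fun τ => seg (V τ) 0 k)
      (∑ j ∈ Finset.range k, seg (V t) (j + 1) k * V' j * seg (V t) 0 j) t := by
  induction k with
  | zero =>
    intro a b
    simpa [seg_self] using hasDerivWithinAt_const t (Set.Ici 0) ((1 : Matrix _ _ ℝ) a b)
  | succ k ih =>
    have h1 := (h k (by omega)).mul (ih (by omega))
    simp only [seg_succ _ (Nat.zero_le k)]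
    convert h1 using 1
    rw [Finset.sum_range_succ, seg_self, Matrix.one_mul, Matrix.mul_sum]
    refine (add_comm _ _).trans (congrArg _ ?_)
    refine Finset.sum_congr rfl fun j hj => ?_
    rw [seg_succ _ (by simpa using hj)]
    simp only [Matrix.mul_assoc]

end MatrixDerivative

/-! ### The end-to-end dynamics -/

section Flow

variable {width : ℕ → ℕ} {M : ℕ}
  {V : ℝ → (i : ℕ) → Matrix (Fin (width (i + 1))) (Fin (width i)) ℝ}
  {γ : ℝ → Matrix (Fin (width (M + 1))) (Fin (width 0)) ℝ}

/-- Gradient flow conserves balancedness. The flow is written in terms of the gradient `γ` of the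
loss with respect to the end-to-end matrix. -/
lemma balanced_of_flow
    (hflow : ∀ t, 0 ≤ t → ∀ i < M + 1, MatDeriv (fun τ => V τ i)
      (-((seg (V t) (i + 1) (M + 1))ᵀ * γ t * (seg (V t) 0 i)ᵀ)) t)
    (h0 : ∀ j, j + 1 < M + 1 → (V 0 (j + 1))ᵀ * V 0 (j + 1) = V 0 j * (V 0 j)ᵀ)
    {t : ℝ} (ht : 0 ≤ t) {j : ℕ} (hj : j + 1 < M + 1) :
    (V t (j + 1))ᵀ * V t (j + 1) = V t j * (V t j)ᵀ := by
  have hd : ∀ τ, 0 ≤ τ → MatDeriv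
      (fun τ => (V τ (j + 1))ᵀ * V τ (j + 1) - V τ j * (V τ j)ᵀ) 0 τ := by
    intro τ hτ
    have h1 := hflow τ hτ (j + 1) hj
    have h2 := hflow τ hτ j (by omega)
    have h3 := (h1.transpose.mul h1).sub (h2.mul h2.transpose)
    convert h3 using 1
    rw [seg_eq_mul_left (V τ) hj, seg_succ (V τ) (Nat.zero_le j)]
    simp only [Matrix.transpose_mul, Matrix.transpose_neg, Matrix.transpose_transpose,
      Matrix.neg_mul, Matrix.mul_neg, Matrix.mul_assoc]
    abel
  have h0' := h0 j hj
  ext a b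
  have := eqOn_Ici_of_hasDerivWithinAt_zero (fun τ hτ => hd τ hτ a b) ht
  simp only [h0', sub_self, Matrix.zero_apply] at this
  exact sub_eq_zero.mp this

/-- The dynamics of the end-to-end vector `w` of a balanced network with one output, where `s` is
the squared norm of the last layer (so `s = ‖w‖ ^ (2 / N)`) and `g` is the gradient of the loss with
respect to `w`. The equation for `w` is multiplied by `s`, so that it holds also where
`s = 0`; the last conjunct says that the loss does not increase. -/
theorem endToEnd_dynamics {e : Fin (width (M + 1))} (he : ∀ a, a = e)
    (hflow : ∀ t, 0 ≤ t → ∀ i < M + 1, MatDeriv (fun τ => V τ i)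
      (-((seg (V t) (i + 1) (M + 1))ᵀ * γ t * (seg (V t) 0 i)ᵀ)) t)
    (h0 : ∀ j, j + 1 < M + 1 → (V 0 (j + 1))ᵀ * V 0 (j + 1) = V 0 j * (V 0 j)ᵀ) :
    ∃ s : ℝ → ℝ, ∀ t, 0 ≤ t → 0 ≤ s t ∧
      s t ^ (M + 1) = ∑ b, seg (V t) 0 (M + 1) e b ^ 2 ∧
      HasDerivWithinAt s (-2 * ∑ b, seg (V t) 0 (M + 1) e b * γ t e b) (Set.Ici 0) t ∧
      ∃ D : Fin (width 0) → ℝ,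
        (∀ b, HasDerivWithinAt (fun τ => seg (V τ) 0 (M + 1) e b) (D b) (Set.Ici 0) t) ∧
        (∀ b, s t * D b = -(s t ^ (M + 1) * γ t e b +
          M * (∑ c, seg (V t) 0 (M + 1) e c * γ t e c) * seg (V t) 0 (M + 1) e b)) ∧
        ∑ b, γ t e b * D b ≤ 0 := by
  refine ⟨fun t => (V t M * (V t M)ᵀ) e e, fun t ht => ?_⟩
  set s := (V t M * (V t M)ᵀ) e e with hs
  have hbal : ∀ j, j + 1 < M + 1 → (V t (j + 1))ᵀ * V t (j + 1) = V t j * (V t j)ᵀ :=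
    fun j hj => balanced_of_flow hflow h0 ht hj
  -- A matrix indexed by the single output is a scalar matrix.
  have hscal : ∀ Q : Matrix (Fin (width (M + 1))) (Fin (width (M + 1))) ℝ, Q = Q e e • 1 := by
    intro Q; ext a b; rw [he a, he b]; simp
  have hsum : ∀ f : Fin (width (M + 1)) → ℝ, ∑ a, f a = f e := by
    intro f
    exact Finset.sum_eq_single_of_mem e (Finset.mem_univ _) fun b _ hb => absurd (he b) hb
  have hD : V t M * (V t M)ᵀ = s • 1 := hscal _
  set Ω := seg (V t) 0 (M + 1) with hΩ
  set G := (V t 0)ᵀ * V t 0 with hG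
  have hGG : G * G = s • G := balanced_gram_sq hbal hD (Nat.zero_le _)
  have hGpow : ∀ j : ℕ, G ^ (j + 1) = s ^ j • G := by
    intro j
    induction j with
    | zero => simp
    | succ j ih => rw [pow_succ, ih, Matrix.smul_mul, hGG, smul_smul, pow_succ]
  have hΩG : Ωᵀ * Ω = s ^ M • G := by
    rw [hΩ, balanced_seg_transpose_mul_seg hbal le_rfl, hGpow]
  have hΩΩ : Ω * Ωᵀ = s ^ (M + 1) • 1 := by
    rw [hΩ, balanced_seg_mul_seg_transpose hbal (Nat.zero_le _), hD, smul_pow, one_pow,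
      Nat.sub_zero]
  have hwg : (γ t * Ωᵀ) e e = ∑ c, Ω e c * γ t e c := by
    rw [Matrix.mul_apply]
    exact Finset.sum_congr rfl fun c _ => by rw [Matrix.transpose_apply, mul_comm]
  refine ⟨?_, ?_, ?_, ?_⟩
  · change 0 ≤ (V t M * (V t M)ᵀ) e e
    rw [Matrix.mul_apply]
    exact Finset.sum_nonneg fun c _ => by rw [Matrix.transpose_apply]; exact mul_self_nonneg _
  · have := congrFun (congrFun hΩΩ e) e
    rw [Matrix.mul_apply] at this
    simpa [sq] using this.symm
  · have h1 := hflow t ht M (by omega)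
    have h2 := (h1.mul h1.transpose) e e
    convert h2 using 1
    have h3 : -((seg (V t) (M + 1) (M + 1))ᵀ * γ t * (seg (V t) 0 M)ᵀ) * (V t M)ᵀ
        = -(γ t * Ωᵀ) := by
      rw [seg_self, hΩ, seg_succ _ (Nat.zero_le _)]
      simp [Matrix.mul_assoc]
    have h4 : V t M * (-((seg (V t) (M + 1) (M + 1))ᵀ * γ t * (seg (V t) 0 M)ᵀ))ᵀ
        = (-(γ t * Ωᵀ))ᵀ := by
      rw [← h3, Matrix.transpose_mul, Matrix.transpose_transpose]
    rw [h3, h4, Matrix.add_apply, Matrix.transpose_apply, Matrix.neg_apply, hwg]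
    ring
  · have h1 := matDeriv_seg (fun i hi => hflow t ht i hi) (le_refl (M + 1))
    set Q := ∑ j ∈ Finset.range (M + 1), seg (V t) (j + 1) (M + 1) *
      (-((seg (V t) (j + 1) (M + 1))ᵀ * γ t * (seg (V t) 0 j)ᵀ)) * seg (V t) 0 j with hQ
    have hQ2 : Q = -∑ j ∈ Finset.range (M + 1), s ^ (M - j) • (γ t * G ^ j) := by
      rw [hQ, ← Finset.sum_neg_distrib]
      refine Finset.sum_congr rfl fun j hj => ?_
      have hj' : j < M + 1 := by simpa using hj
      have hU := balanced_seg_mul_seg_transpose hbal (i := j + 1) (by omega)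
      rw [hD, smul_pow, one_pow, Nat.add_sub_add_right] at hU
      rw [← balanced_seg_transpose_mul_seg hbal (k := j) (by omega)]
      calc _ = -((seg (V t) (j + 1) (M + 1) * (seg (V t) (j + 1) (M + 1))ᵀ) *
            (γ t * ((seg (V t) 0 j)ᵀ * seg (V t) 0 j))) := by
            simp only [Matrix.mul_assoc, Matrix.neg_mul, Matrix.mul_neg]
        _ = _ := by rw [hU, Matrix.smul_mul, Matrix.one_mul]
    refine ⟨fun b => Q e b, fun b => h1 e b, fun b => ?_, ?_⟩
    · have h2 : s • Q = -(s ^ (M + 1) • γ t + (M : ℝ) • (γ t * (Ωᵀ * Ω))) := by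
        rw [hQ2, smul_neg, Finset.smul_sum, Finset.sum_range_succ', hΩG]
        refine congrArg _ ((add_comm _ _).trans (congrArg₂ _ ?_ ?_))
        · simp [smul_smul, pow_succ']
        · rw [Finset.sum_congr rfl (g := fun _ => s ^ M • (γ t * G))]
          · simp [Nat.cast_smul_eq_nsmul]
          · intro j hj
            have hj' : j < M := by simpa using hj
            rw [hGpow, Matrix.mul_smul, smul_smul, smul_smul, ← pow_succ', ← pow_add]
            congr 2
            omega
      have h3 := congrFun (congrFun h2 e) b
      rw [Matrix.smul_apply, smul_eq_mul] at h3
      change s * Q e b = _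
      rw [h3, ← Matrix.mul_assoc, hscal (γ t * Ωᵀ), hwg]
      simp only [Matrix.neg_apply, Matrix.add_apply, Matrix.smul_apply, Matrix.smul_mul,
        Matrix.one_mul, smul_eq_mul, mul_assoc]
      rfl
    · -- Each layer contributes minus the squared norm of its partial gradient.
      have h2 : ∑ b, γ t e b * Q e b = (Q * (γ t)ᵀ) e e := by
        rw [Matrix.mul_apply]
        exact Finset.sum_congr rfl fun c _ => by rw [Matrix.transpose_apply, mul_comm]
      rw [h2, hQ, Matrix.sum_mul, Matrix.sum_apply]
      refine Finset.sum_nonpos fun j _ => ?_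
      have h3 : seg (V t) (j + 1) (M + 1) *
          (-((seg (V t) (j + 1) (M + 1))ᵀ * γ t * (seg (V t) 0 j)ᵀ)) * seg (V t) 0 j * (γ t)ᵀ
          = -((seg (V t) (j + 1) (M + 1) * (seg (V t) (j + 1) (M + 1))ᵀ) *
            ((γ t * (seg (V t) 0 j)ᵀ) * (γ t * (seg (V t) 0 j)ᵀ)ᵀ)) := by
        simp only [Matrix.mul_assoc, Matrix.neg_mul, Matrix.mul_neg, Matrix.transpose_mul,
          Matrix.transpose_transpose]
      rw [h3, Matrix.neg_apply, Matrix.mul_apply, hsum, neg_nonpos]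
      refine mul_nonneg ?_ ?_ <;> rw [Matrix.mul_apply] <;>
        exact Finset.sum_nonneg fun c _ => by rw [Matrix.transpose_apply]; exact mul_self_nonneg _

end Flow

/-! ### The cross-entropy and its gradient -/

section Loss

variable {d n : ℕ} (wstar : Vec d) (x : Fin n → Vec d)

/-- The cross-entropy of the label `y` and the prediction `σ(u)`. -/
noncomputable def logisticLoss (y u : ℝ) : ℝ :=
  -(y * Real.log (Real.sigmoid u) + (1 - y) * Real.log (1 - Real.sigmoid u))

lemma hasDerivAt_logisticLoss (y u : ℝ) :
    HasDerivAt (logisticLoss y) (Real.sigmoid u - y) u := by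
  have h0 := Real.hasDerivAt_sigmoid u
  have hp := (Real.sigmoid_pos u).ne'
  have hq := (sub_pos.mpr (Real.sigmoid_lt_one u)).ne'
  have h1 := h0.log hp
  have h2 := (h0.const_sub 1).log hq
  refine ((h1.const_mul y).add (h2.const_mul (1 - y))).neg.congr_deriv ?_
  generalize Real.sigmoid u = σ at *
  have e1 : y * (σ * (1 - σ) / σ) = y * (1 - σ) := by rw [mul_div_assoc, mul_div_cancel₀ _ hp]
  have e2 : (1 - y) * (-(σ * (1 - σ)) / (1 - σ)) = -((1 - y) * σ) := by field_simp
  rw [e1, e2]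
  ring

lemma min_mul_abs_le_logisticLoss {y : ℝ} (hy : 0 < y) (hy1 : y < 1) (u : ℝ) :
    min y (1 - y) * |u| ≤ logisticLoss y u := by
  have h1 : Real.log (Real.sigmoid u) ≤ min 0 u := by
    refine le_min (Real.log_nonpos (Real.sigmoid_nonneg u) (Real.sigmoid_le_one u)) ?_
    rw [Real.log_le_iff_le_exp (Real.sigmoid_pos u)]
    have h := Real.sigmoid_mul_rexp_neg u
    have h' : Real.sigmoid u = Real.sigmoid (-u) * Real.exp u := by
      rw [← h, mul_assoc, ← Real.exp_add]; simp
    rw [h']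
    exact mul_le_of_le_one_left (Real.exp_pos u).le (Real.sigmoid_le_one _)
  have h2 : Real.log (1 - Real.sigmoid u) ≤ min 0 (-u) := by
    rw [← Real.sigmoid_neg]
    refine le_min (Real.log_nonpos (Real.sigmoid_nonneg _) (Real.sigmoid_le_one _)) ?_
    rw [Real.log_le_iff_le_exp (Real.sigmoid_pos _), ← Real.sigmoid_mul_rexp_neg]
    exact mul_le_of_le_one_left (Real.exp_pos _).le (Real.sigmoid_le_one _)
  have h3 := min_le_left y (1 - y)
  have h4 := min_le_right y (1 - y)
  have h5 := le_min_iff.mp h1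
  have h6 := le_min_iff.mp h2
  unfold logisticLoss
  rcases le_total 0 u with hu | hu
  · rw [abs_of_nonneg hu]; nlinarith
  · rw [abs_of_nonpos hu]; nlinarith

lemma logisticLoss_nonneg {y : ℝ} (hy : 0 < y) (hy1 : y < 1) (u : ℝ) : 0 ≤ logisticLoss y u :=
  (mul_nonneg (le_min hy.le (by linarith)) (abs_nonneg u)).trans
    (min_mul_abs_le_logisticLoss hy hy1 u)

lemma crossEntropy_eq (w : Vec d) : crossEntropy wstar x w =
    (1 / (n : ℝ)) * ∑ i, logisticLoss (softLabel wstar x i) (inner ℝ w (x i)) := by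
  simp only [crossEntropy, logisticLoss, Finset.sum_neg_distrib]
  ring

/-- The gradient of the cross-entropy. -/
noncomputable def lossGrad (w : Vec d) : Vec d :=
  (1 / (n : ℝ)) • ∑ i, (Real.sigmoid (inner ℝ w (x i)) - softLabel wstar x i) • x i

lemma hasFDerivAt_crossEntropy (w : Vec d) :
    HasFDerivAt (crossEntropy wstar x) (innerSL ℝ (lossGrad wstar x w)) w := by
  have h1 : ∀ i, HasFDerivAt (fun w : Vec d => inner ℝ w (x i)) (innerSL ℝ (x i)) w := by
    intro i
    have := (innerSL ℝ (x i)).hasFDerivAt (x := w)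
    simpa [real_inner_comm] using this
  have h2 := HasFDerivAt.fun_sum (u := Finset.univ) fun i _ =>
    (hasDerivAt_logisticLoss (softLabel wstar x i) (inner ℝ w (x i))).comp_hasFDerivAt w (h1 i)
  have h3 := h2.const_mul (1 / (n : ℝ))
  rw [show crossEntropy wstar x = _ from funext (crossEntropy_eq wstar x)]
  refine h3.congr_fderiv ?_
  rw [lossGrad, map_smul, map_sum]
  simp only [map_smul]

lemma continuous_lossGrad : Continuous (lossGrad wstar x) := by
  unfold lossGrad
  fun_prop

lemma continuous_crossEntropy : Continuous (crossEntropy wstar x) :=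
  continuous_iff_continuousAt.mpr fun w => (hasFDerivAt_crossEntropy wstar x w).continuousAt

lemma hasFDerivAt_loss (w : Vec d) :
    HasFDerivAt (loss wstar x) (innerSL ℝ (lossGrad wstar x w)) w :=
  (hasFDerivAt_crossEntropy wstar x w).sub_const _

end Loss

/-! ### The gradient with respect to the layers -/

section Layers

variable {d n N : ℕ} {A : Architecture d N}

/-- The layers as a family indexed by all natural numbers, with `0` for the indices beyond the last
layer. -/
noncomputable def layers (W : Weights A) (i : ℕ) :
    Matrix (Fin (A.width (i + 1))) (Fin (A.width i)) ℝ :=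
  if h : i < N then W ⟨i, h⟩ else 0

lemma layers_apply (W : Weights A) (i : Fin N) : layers W i = W i := by
  simp [layers]

lemma partialProd_eq_seg (W : Weights A) (k : ℕ) (hk : k ≤ N) :
    partialProd W k hk = seg (layers W) 0 k := by
  induction k with
  | zero => rw [partialProd, seg_self]
  | succ k ih => rw [partialProd, ih, seg_succ _ (Nat.zero_le k), ← layers_apply W ⟨k, hk⟩]

/-- The index of the single output. -/
def Architecture.out (A : Architecture d N) : Fin (A.width N) := Fin.cast A.width_last.symm 0

lemma Architecture.eq_out (A : Architecture d N) (a : Fin (A.width N)) : a = A.out := by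
  have h := A.width_last
  have h1 := a.isLt
  have h2 := A.out.isLt
  exact Fin.ext (by omega)

lemma endToEnd_apply (W : Weights A) (j : Fin d) :
    endToEnd W j = seg (layers W) 0 N A.out (Fin.cast A.width_zero.symm j) := by
  rw [← partialProd_eq_seg W N le_rfl]
  rfl

lemma endToEnd_update (W : Weights A) (i : Fin N) (a : Fin (A.width (i.val + 1)))
    (b : Fin (A.width i.val)) (s : ℝ) :
    endToEnd (Function.update W i (W i + s • Matrix.single a b (1 : ℝ))) =
      endToEnd W + s • WithLp.toLp 2 fun j => seg (layers W) (i + 1) N A.out a *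
        seg (layers W) 0 i b (Fin.cast A.width_zero.symm j) := by
  set W' := Function.update W i (W i + s • Matrix.single a b (1 : ℝ)) with hW'
  have hne : ∀ j : ℕ, j ≠ i → layers W' j = layers W j := by
    intro j hj
    unfold layers
    split_ifs with h
    · rw [hW', Function.update_of_ne (by rintro rfl; exact hj rfl)]
    · rfl
  have heq : layers W' i = layers W i + s • Matrix.single a b (1 : ℝ) := by
    rw [layers_apply, layers_apply, hW', Function.update_self]
  have h1 : seg (layers W') (i + 1) N = seg (layers W) (i + 1) N :=
    seg_congr i.isLt fun j h1 h2 => hne j (by omega)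
  have h2 : seg (layers W') 0 i = seg (layers W) 0 i :=
    seg_congr (Nat.zero_le _) fun j h1 h2 => hne j (by omega)
  ext j
  rw [PiLp.add_apply, PiLp.smul_apply, endToEnd_apply, endToEnd_apply,
    ← seg_mul_seg_mul (layers W') i.isLt, ← seg_mul_seg_mul (layers W) i.isLt, heq, h1, h2,
    Matrix.mul_add, Matrix.add_mul, Matrix.add_apply, Matrix.mul_smul, Matrix.smul_mul,
    Matrix.smul_apply]
  congr 2
  rw [Matrix.mul_apply, Finset.sum_eq_single b]
  · simp
  · intro c _ hc
    rw [Matrix.mul_single_apply_of_ne _ _ _ _ _ hc, zero_mul]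
  · simp

/-- The gradient of the loss with respect to the end-to-end matrix, as a matrix with one row. -/
noncomputable def gradRow (A : Architecture d N) (g : Vec d) :
    Matrix (Fin (A.width N)) (Fin (A.width 0)) ℝ :=
  Matrix.of fun _ b => g (Fin.cast A.width_zero b)

lemma sum_cast_width_zero (A : Architecture d N) (f : Fin d → ℝ) :
    ∑ b, f (Fin.cast A.width_zero b) = ∑ j, f j :=
  Equiv.sum_comp (finCongr A.width_zero) f

/-- The chain rule for the loss of the network. -/
lemma partialGrad_deepLoss (wstar : Vec d) (x : Fin n → Vec d) (W : Weights A) (i : Fin N) :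
    partialGrad (deepLoss wstar x) W i = (seg (layers W) (i + 1) N)ᵀ *
      gradRow A (lossGrad wstar x (endToEnd W)) * (seg (layers W) 0 i)ᵀ := by
  ext a b
  set g := lossGrad wstar x (endToEnd W) with hg
  set u : Vec d := WithLp.toLp 2 fun j => seg (layers W) (i + 1) N A.out a *
    seg (layers W) 0 i b (Fin.cast A.width_zero.symm j) with hu
  have h1 : HasDerivAt (fun s : ℝ => endToEnd W + s • u) u 0 := by
    simpa using ((hasDerivAt_id (0 : ℝ)).smul_const u).const_add (endToEnd W)
  have h2 : HasFDerivAt (loss wstar x) (innerSL ℝ g) (endToEnd W + (0 : ℝ) • u) := by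
    rw [zero_smul, add_zero]; exact hasFDerivAt_loss wstar x _
  have h3 := (h2.comp_hasDerivAt (0 : ℝ) h1).deriv
  rw [partialGrad, Matrix.of_apply]
  simp only [deepLoss, endToEnd_update]
  refine h3.trans ?_
  rw [innerSL_apply_apply, PiLp.inner_apply, ← sum_cast_width_zero A, Matrix.mul_apply]
  refine Finset.sum_congr rfl fun c _ => ?_
  rw [Matrix.mul_apply, Finset.sum_eq_single A.out
    (fun b _ hb => absurd (A.eq_out b) hb) (by simp)]
  simp [hu, gradRow]
  ring

/-- The dynamics of the end-to-end vector in vector form; see `endToEnd_dynamics`. -/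
theorem exists_endToEnd_dynamics {M : ℕ} {A : Architecture d (M + 1)} (wstar : Vec d)
    (x : Fin n → Vec d) {W : ℝ → Weights A} (hW : IsGradientFlow wstar x W)
    (hb : Balanced (W 0)) :
    ∃ s : ℝ → ℝ, ∀ t, 0 ≤ t → 0 ≤ s t ∧
      s t ^ (M + 1) = ‖endToEnd (W t)‖ ^ 2 ∧
      HasDerivWithinAt s (-2 * inner ℝ (endToEnd (W t)) (lossGrad wstar x (endToEnd (W t))))
        (Set.Ici 0) t ∧
      ∃ D : Vec d, HasDerivWithinAt (fun τ => endToEnd (W τ)) D (Set.Ici 0) t ∧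
        s t • D = -(s t ^ (M + 1) • lossGrad wstar x (endToEnd (W t)) +
          (M * inner ℝ (endToEnd (W t)) (lossGrad wstar x (endToEnd (W t)))) • endToEnd (W t)) ∧
        inner ℝ (lossGrad wstar x (endToEnd (W t))) D ≤ 0 := by
  have hflow : ∀ t, 0 ≤ t → ∀ i < M + 1, MatDeriv (fun τ => layers (W τ) i)
      (-((seg (layers (W t)) (i + 1) (M + 1))ᵀ *
        gradRow A (lossGrad wstar x (endToEnd (W t))) * (seg (layers (W t)) 0 i)ᵀ)) t := by
    intro t ht i hi a b
    have h := hW t ht ⟨i, hi⟩ a b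
    rw [partialGrad_deepLoss] at h
    have h' : ∀ τ, layers (W τ) i = W τ ⟨i, hi⟩ := fun τ => layers_apply (W τ) ⟨i, hi⟩
    simpa only [h', Matrix.neg_apply] using h
  have hb' : ∀ j, j + 1 < M + 1 → (layers (W 0) (j + 1))ᵀ * layers (W 0) (j + 1) =
      layers (W 0) j * (layers (W 0) j)ᵀ := by
    intro j hj
    have h := hb j hj
    rw [← layers_apply (W 0) ⟨j + 1, hj⟩, ← layers_apply (W 0) ⟨j, _⟩] at h
    exact h
  obtain ⟨s, hs⟩ := endToEnd_dynamics (V := fun t => layers (W t))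
    (γ := fun t => gradRow A (lossGrad wstar x (endToEnd (W t)))) A.eq_out hflow hb'
  refine ⟨s, fun t ht => ?_⟩
  obtain ⟨h1, h2, h3, D, h4, h5, h6⟩ := hs t ht
  set g := lossGrad wstar x (endToEnd (W t))
  have hseg : ∀ b, seg (layers (W t)) 0 (M + 1) A.out b =
      endToEnd (W t) (Fin.cast A.width_zero b) := fun b => by rw [endToEnd_apply]; rfl
  have hinner : ∑ b, seg (layers (W t)) 0 (M + 1) A.out b * gradRow A g A.out b =
      inner ℝ (endToEnd (W t)) g := by
    rw [PiLp.inner_apply, ← sum_cast_width_zero A]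
    refine Finset.sum_congr rfl fun b _ => ?_
    simp [hseg, gradRow, mul_comm]
  refine ⟨h1, ?_, ?_, WithLp.toLp 2 fun j => D (Fin.cast A.width_zero.symm j), ?_, ?_, ?_⟩
  · rw [h2, EuclideanSpace.real_norm_sq_eq, ← sum_cast_width_zero A]
    simp only [hseg]
  · simpa only [hinner] using h3
  · have h : HasDerivWithinAt
        (fun τ => fun j : Fin d =>
          seg (layers (W τ)) 0 (M + 1) A.out (Fin.cast A.width_zero.symm j))
        (fun j => D (Fin.cast A.width_zero.symm j)) (Set.Ici 0) t :=
      hasDerivWithinAt_pi.mpr fun j => h4 _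
    simp only [← endToEnd_apply] at h
    let Φ := (PiLp.continuousLinearEquiv 2 ℝ (fun _ : Fin d => ℝ)).symm.toContinuousLinearMap
    exact Φ.hasFDerivAt.comp_hasDerivWithinAt t h
  · ext j
    have h := h5 (Fin.cast A.width_zero.symm j)
    simp only [hinner] at h
    rw [hseg] at h
    simpa [gradRow] using h
  · rw [PiLp.inner_apply, ← sum_cast_width_zero A]
    refine le_of_eq_of_le (Finset.sum_congr rfl fun b _ => ?_) h6
    simp [gradRow, mul_comm]

end Layers

/-! ### The loss on the span of the data -/

section Span

variable {d n : ℕ} {wstar : Vec d} {x : Fin n → Vec d}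

lemma softLabel_pos (i : Fin n) : 0 < softLabel wstar x i := Real.sigmoid_pos _

lemma softLabel_lt_one (i : Fin n) : softLabel wstar x i < 1 := Real.sigmoid_lt_one _

/-- The span of the inputs. -/
noncomputable def dataSpan (x : Fin n → Vec d) : Submodule ℝ (Vec d) :=
  Submodule.span ℝ (Set.range x)

lemma mem_dataSpan (x : Fin n → Vec d) (i : Fin n) : x i ∈ dataSpan x :=
  Submodule.subset_span ⟨i, rfl⟩

lemma lossGrad_mem_dataSpan (w : Vec d) : lossGrad wstar x w ∈ dataSpan x :=
  Submodule.smul_mem _ _ (Submodule.sum_mem _ fun i _ =>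
    Submodule.smul_mem _ _ (mem_dataSpan x i))

lemma eq_of_mem_dataSpan {u v : Vec d} (hu : u ∈ dataSpan x) (hv : v ∈ dataSpan x)
    (h : ∀ i, inner ℝ u (x i) = (inner ℝ v (x i) : ℝ)) : u = v := by
  have h1 : u - v ∈ (dataSpan x)ᗮ := by
    rw [dataSpan, Submodule.mem_orthogonal']
    intro z hz
    induction hz using Submodule.span_induction with
    | mem z hz => obtain ⟨i, rfl⟩ := hz; rw [inner_sub_left, h i, sub_self]
    | zero => exact inner_zero_right _
    | add y z _ _ hy hz => rw [inner_add_right, hy, hz, add_zero]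
    | smul c z _ hz => rw [inner_smul_right, hz, mul_zero]
  have h2 : u - v ∈ dataSpan x := Submodule.sub_mem _ hu hv
  have h3 := (Submodule.mem_orthogonal _ _).mp h1 _ h2
  exact sub_eq_zero.mp (inner_self_eq_zero.mp h3)

lemma inner_starProjection_dataSpan (w : Vec d) (i : Fin n) :
    inner ℝ ((dataSpan x).starProjection w) (x i) = (inner ℝ w (x i) : ℝ) := by
  rw [Submodule.inner_starProjection_left_eq_right,
    Submodule.starProjection_eq_self_iff.mpr (mem_dataSpan x i)]

lemma crossEntropy_starProjection (w : Vec d) :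
    crossEntropy wstar x ((dataSpan x).starProjection w) = crossEntropy wstar x w := by
  simp only [crossEntropy, inner_starProjection_dataSpan]

lemma lossGrad_starProjection (w : Vec d) :
    lossGrad wstar x ((dataSpan x).starProjection w) = lossGrad wstar x w := by
  simp only [lossGrad, inner_starProjection_dataSpan]

/-- Critical points of the loss predict the labels exactly, as `σ` is strictly monotone. -/
lemma inner_eq_of_lossGrad_eq_zero (hn : 0 < n) {v : Vec d} (h : lossGrad wstar x v = 0)
    (i : Fin n) : inner ℝ v (x i) = (inner ℝ wstar (x i) : ℝ) := by
  have hn' : (0 : ℝ) < n := by exact_mod_cast hn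
  have h1 : ∑ i, (Real.sigmoid (inner ℝ v (x i)) - softLabel wstar x i) • x i = 0 :=
    (smul_eq_zero.mp h).resolve_left (by positivity)
  have h2 : ∑ i, (Real.sigmoid (inner ℝ v (x i)) - Real.sigmoid (inner ℝ wstar (x i))) *
      (inner ℝ v (x i) - inner ℝ wstar (x i)) = 0 := by
    have h3 := congrArg (fun z => (inner ℝ (v - wstar) z : ℝ)) h1
    simp only [inner_sum, inner_smul_right, inner_zero_right, inner_sub_left] at h3
    exact h3
  have hmul : ∀ a b : ℝ, 0 ≤ (Real.sigmoid a - Real.sigmoid b) * (a - b) := by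
    intro a b
    rcases le_total a b with hab | hab
    · exact mul_nonneg_of_nonpos_of_nonpos (sub_nonpos.mpr (Real.sigmoid_le hab))
        (sub_nonpos.mpr hab)
    · exact mul_nonneg (sub_nonneg.mpr (Real.sigmoid_le hab)) (sub_nonneg.mpr hab)
  have h3 := (Finset.sum_eq_zero_iff_of_nonneg fun i _ => hmul _ _).mp h2 i (Finset.mem_univ i)
  rcases mul_eq_zero.mp h3 with h4 | h4
  · exact Real.sigmoid_injective (sub_eq_zero.mp h4)
  · exact sub_eq_zero.mp h4

/-- The loss is coercive on the span of the data: the labels lie in the open interval `(0, 1)`. -/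
lemma isCompact_sublevel (hn : 0 < n) (c : ℝ) :
    IsCompact {v : Vec d | v ∈ dataSpan x ∧ crossEntropy wstar x v ≤ c} := by
  have hn' : (0 : ℝ) < n := by exact_mod_cast hn
  refine Metric.isCompact_of_isClosed_isBounded ?_ ?_
  · exact (Submodule.closed_of_finiteDimensional (dataSpan x)).inter
      (isClosed_le (continuous_crossEntropy wstar x) continuous_const)
  · let T : dataSpan x →ₗ[ℝ] (Fin n → ℝ) :=
      { toFun := fun v i => inner ℝ (v : Vec d) (x i)
        map_add' := fun u v => by ext i; simp [inner_add_left]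
        map_smul' := fun r v => by ext i; simp [inner_smul_left] }
    have hT : LinearMap.ker T = ⊥ := by
      rw [LinearMap.ker_eq_bot]
      intro u v huv
      exact Subtype.ext (eq_of_mem_dataSpan u.2 v.2 fun i => congrFun huv i)
    obtain ⟨K, -, hK⟩ := T.exists_antilipschitzWith hT
    choose m hm using fun i : Fin n =>
      (⟨min (softLabel wstar x i) (1 - softLabel wstar x i),
        lt_min (softLabel_pos i) (sub_pos.mpr (softLabel_lt_one i)),
        fun u => min_mul_abs_le_logisticLoss (softLabel_pos i) (softLabel_lt_one i) u⟩ :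
        ∃ m : ℝ, 0 < m ∧ ∀ u, m * |u| ≤ logisticLoss (softLabel wstar x i) u)
    rw [isBounded_iff_forall_norm_le]
    refine ⟨K * ∑ i, |n * c / m i|, fun v ⟨hv, hvc⟩ => ?_⟩
    have h1 := hK.le_mul_dist ⟨v, hv⟩ 0
    rw [map_zero, dist_zero_right, dist_zero_right] at h1
    refine h1.trans (mul_le_mul_of_nonneg_left ?_ K.2)
    refine (pi_norm_le_iff_of_nonneg (Finset.sum_nonneg fun _ _ => abs_nonneg _)).mpr fun i => ?_
    have h2 : ∑ i, logisticLoss (softLabel wstar x i) (inner ℝ v (x i)) ≤ n * c := by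
      rw [crossEntropy_eq, one_div, inv_mul_le_iff₀ hn'] at hvc
      exact hvc
    have h3 : logisticLoss (softLabel wstar x i) (inner ℝ v (x i)) ≤ n * c :=
      (Finset.single_le_sum (f := fun i => logisticLoss (softLabel wstar x i) (inner ℝ v (x i)))
        (fun j _ => logisticLoss_nonneg (softLabel_pos j) (softLabel_lt_one j) _)
        (Finset.mem_univ i)).trans h2
    have h4 : |inner ℝ v (x i)| ≤ n * c / m i := by
      rw [le_div_iff₀ (hm i).1, mul_comm]
      exact ((hm i).2 _).trans h3
    exact (h4.trans (le_abs_self _)).trans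
      (Finset.single_le_sum (f := fun i => |n * c / m i|) (fun _ _ => abs_nonneg _)
        (Finset.mem_univ i))

lemma lossGrad_eq_zero_of_isMin {v : Vec d}
    (h : ∀ w, crossEntropy wstar x v ≤ crossEntropy wstar x w) : lossGrad wstar x v = 0 := by
  have h1 : IsLocalMin (crossEntropy wstar x) v := Eventually.of_forall h
  have h2 := h1.hasFDerivAt_eq_zero (hasFDerivAt_crossEntropy wstar x v)
  have h3 := DFunLike.congr_fun h2 (lossGrad wstar x v)
  rw [innerSL_apply_apply, zero_apply] at h3
  exact inner_self_eq_zero.mp h3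

/-- The projection of the teacher to the span of the data is the unique minimizer of the loss
there. It is found as the minimizer on a compact sublevel set, whose gradient vanishes. -/
lemma crossEntropy_lt_of_ne (hn : 0 < n) {what v : Vec d} (hmem : what ∈ dataSpan x)
    (hwhat : ∀ i, inner ℝ what (x i) = (inner ℝ wstar (x i) : ℝ)) (hv : v ∈ dataSpan x)
    (hne : v ≠ what) : crossEntropy wstar x what < crossEntropy wstar x v := by
  have hcrit : ∀ u ∈ dataSpan x, lossGrad wstar x u = 0 → u = what := fun u hu hu0 =>
    eq_of_mem_dataSpan hu hmem fun i => by rw [inner_eq_of_lossGrad_eq_zero hn hu0, hwhat]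
  have hmin : ∀ w, crossEntropy wstar x what ≤ crossEntropy wstar x w := by
    obtain ⟨u, ⟨hu, huc⟩, humin⟩ := (isCompact_sublevel (wstar := wstar) (x := x) hn
      (crossEntropy wstar x what)).exists_isMinOn ⟨what, hmem, le_rfl⟩
      (continuous_crossEntropy wstar x).continuousOn
    have hall : ∀ w, crossEntropy wstar x u ≤ crossEntropy wstar x w := by
      intro w
      rw [← crossEntropy_starProjection w]
      by_cases hw : crossEntropy wstar x ((dataSpan x).starProjection w) ≤
          crossEntropy wstar x what
      · exact humin ⟨Submodule.starProjection_apply_mem _ w, hw⟩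
      · exact huc.trans (le_of_not_ge hw)
    rwa [hcrit u hu (lossGrad_eq_zero_of_isMin hall)] at hall
  refine lt_of_le_of_ne (hmin v) fun heq => hne (hcrit v hv (lossGrad_eq_zero_of_isMin ?_))
  exact fun w => heq ▸ hmin w

lemma lossGrad_ne_zero (hn : 0 < n) {what v : Vec d} (hmem : what ∈ dataSpan x)
    (hwhat : ∀ i, inner ℝ what (x i) = (inner ℝ wstar (x i) : ℝ)) (hv : v ∈ dataSpan x)
    (hne : v ≠ what) : lossGrad wstar x v ≠ 0 := fun h =>
  hne (eq_of_mem_dataSpan hv hmem fun i => by rw [inner_eq_of_lossGrad_eq_zero hn h, hwhat])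

end Span

/-! ### The span of random inputs -/

section Random

variable {d : ℕ}

lemma measurableSet_setOf_rows_linearIndependent (n : ℕ) :
    MeasurableSet {x : Fin n → Vec d | LinearIndependent ℝ fun (k : Fin d) (i : Fin n) => x i k} :=
  (isOpen_setOfPred_linearIndependent.preimage
    (f := fun (x : Fin n → Vec d) (k : Fin d) (i : Fin n) => x i k) (by fun_prop)).measurableSet

lemma span_eq_top_iff_linearIndependent_rows {n : ℕ} (x : Fin n → Vec d) :
    dataSpan x = ⊤ ↔ LinearIndependent ℝ fun (k : Fin d) (i : Fin n) => x i k := by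
  have key : ∀ u : Vec d, (∑ k, u k • (fun i => x i k) = (0 : Fin n → ℝ)) ↔
      u ∈ (dataSpan x)ᗮ := by
    intro u
    have h1 : u ∈ (dataSpan x)ᗮ ↔ ∀ i, inner ℝ u (x i) = (0 : ℝ) := by
      rw [Submodule.mem_orthogonal']
      refine ⟨fun h i => h _ (mem_dataSpan x i), fun h z hz => ?_⟩
      induction hz using Submodule.span_induction with
      | mem z hz => obtain ⟨i, rfl⟩ := hz; exact h i
      | zero => exact inner_zero_right _
      | add y z _ _ hy hz => rw [inner_add_right, hy, hz, add_zero]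
      | smul c z _ hz => rw [inner_smul_right, hz, mul_zero]
    rw [h1, funext_iff]
    refine forall_congr' fun i => ?_
    rw [Finset.sum_apply, PiLp.inner_apply]
    simp [mul_comm]
  rw [← Submodule.orthogonal_eq_bot_iff, Submodule.eq_bot_iff, Fintype.linearIndependent_iff]
  constructor
  · intro h c hc k
    have := h (WithLp.toLp 2 c) ((key _).mp hc)
    exact congrFun (congrArg WithLp.ofLp this) k
  · intro h u hu
    ext k
    exact h u ((key u).mpr hu) k

/-- Random inputs with a density are almost surely in general position. -/
lemma ae_linearIndependent_or_span_eq_top (P : Measure (Vec d)) [SigmaFinite P]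
    (hP : P ≪ volume) (n : ℕ) :
    ∀ᵐ x ∂(Measure.pi fun _ : Fin n => P), LinearIndependent ℝ x ∨ dataSpan x = ⊤ := by
  induction n with
  | zero => exact Eventually.of_forall fun x => Or.inl linearIndependent_empty_type
  | succ n ih =>
    have hmp := measurePreserving_piFinSuccAbove (fun _ : Fin (n + 1) => P) 0
    have hmeas : MeasurableSet
        {x : Fin (n + 1) → Vec d | LinearIndependent ℝ x ∨ dataSpan x = ⊤} := by
      refine (isOpen_setOfPred_linearIndependent.measurableSet).union ?_
      simp only [span_eq_top_iff_linearIndependent_rows]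
      exact measurableSet_setOf_rows_linearIndependent _
    have hcons : ∀ z : Vec d × (Fin n → Vec d),
        (MeasurableEquiv.piFinSuccAbove (fun _ : Fin (n + 1) => Vec d) 0).symm z =
          (Fin.cons z.1 z.2 : Fin (n + 1) → Vec d) := fun z => Fin.insertNth_zero' z.1 z.2
    have hprod : ∀ᵐ z ∂(P.prod (Measure.pi fun _ : Fin n => P)),
        LinearIndependent ℝ (Fin.cons z.1 z.2 : Fin (n + 1) → Vec d) ∨
          dataSpan (Fin.cons z.1 z.2 : Fin (n + 1) → Vec d) = ⊤ := by
      have hmeas' :=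
        (MeasurableEquiv.piFinSuccAbove (fun _ : Fin (n + 1) => Vec d) 0).symm.measurable hmeas
      simp only [Set.preimage_ofPred_eq, hcons] at hmeas'
      rw [Measure.ae_prod_iff_ae_ae hmeas', Measure.ae_ae_comm hmeas']
      filter_upwards [ih] with z hz
      by_cases htop : dataSpan z = ⊤
      · refine Eventually.of_forall fun y => Or.inr (top_le_iff.mp (htop ▸ ?_))
        refine Submodule.span_mono ?_
        rintro _ ⟨i, rfl⟩
        exact ⟨i.succ, Fin.cons_succ _ _ _⟩
      · have hnull : P (dataSpan z : Set (Vec d)) = 0 :=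
          hP (Measure.addHaar_submodule volume (dataSpan z) htop)
        filter_upwards [measure_eq_zero_iff_ae_notMem.mp hnull] with y hy
        exact Or.inl (linearIndependent_finCons.mpr ⟨hz.resolve_right htop, hy⟩)
    have h := hmp.quasiMeasurePreserving.ae hprod
    filter_upwards [h] with y hy
    rwa [← hcons, MeasurableEquiv.symm_apply_apply] at hy

/-- Gram matrices of linearly independent families are invertible. -/
lemma isUnit_gram_of_linearIndependent {n : ℕ} {x : Fin n → Vec d} (h : LinearIndependent ℝ x) :
    IsUnit ((dataMatrix x)ᵀ * dataMatrix x) := by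
  rw [← Matrix.mulVec_injective_iff_isUnit]
  have hinj : Function.Injective (dataMatrix x).mulVec := by
    rw [Matrix.mulVec_injective_iff]
    have h' := h.map' (WithLp.linearEquiv 2 ℝ (Fin d → ℝ)).toLinearMap (LinearEquiv.ker _)
    exact h'
  intro u v huv
  apply hinj
  have h1 : ((dataMatrix x)ᵀ * dataMatrix x) *ᵥ (u - v) = 0 := by
    rw [Matrix.mulVec_sub]; exact sub_eq_zero.mpr huv
  rw [← Matrix.conjTranspose_eq_transpose_of_trivial,
    Matrix.conjTranspose_mul_self_mulVec_eq_zero, Matrix.mulVec_sub] at h1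
  exact sub_eq_zero.mp h1

lemma ae_isUnit_gram (P : Measure (Vec d)) [SigmaFinite P] (hP : P ≪ volume) {n : ℕ}
    (hn : n < d) : ∀ᵐ x ∂(Measure.pi fun _ : Fin n => P),
      IsUnit ((dataMatrix x)ᵀ * dataMatrix x) := by
  filter_upwards [ae_linearIndependent_or_span_eq_top P hP n] with x hx
  rcases hx with hx | hx
  · exact isUnit_gram_of_linearIndependent hx
  · have h1 : Module.finrank ℝ (dataSpan x) ≤ Fintype.card (Fin n) := finrank_range_le_card x
    rw [hx, finrank_top, finrank_euclideanSpace_fin, Fintype.card_fin] at h1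
    omega

lemma ae_dataSpan_eq_top (P : Measure (Vec d)) [SigmaFinite P] (hP : P ≪ volume) {n : ℕ}
    (hn : d ≤ n) : ∀ᵐ x ∂(Measure.pi fun _ : Fin n => P), dataSpan x = ⊤ := by
  filter_upwards [ae_linearIndependent_or_span_eq_top P hP n] with x hx
  rcases hx with hx | hx
  · refine hx.span_eq_top_of_card_eq_finrank' (le_antisymm ?_ ?_)
    · exact hx.fintype_card_le_finrank
    · simpa using hn
  · exact hx

/-- `ŵ` is the orthogonal projection of the teacher to the span of the data. -/
lemma wHat_mem_dataSpan_and_inner {n : ℕ} {wstar : Vec d} {x : Fin n → Vec d} (hn : n < d)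
    (hx : IsUnit ((dataMatrix x)ᵀ * dataMatrix x)) :
    wHat wstar x ∈ dataSpan x ∧
      ∀ i, inner ℝ (wHat wstar x) (x i) = (inner ℝ wstar (x i) : ℝ) := by
  set X := dataMatrix x with hX
  have hw : wHat wstar x = WithLp.toLp 2 (X *ᵥ ((Xᵀ * X)⁻¹ *ᵥ (Xᵀ *ᵥ wstar.ofLp))) := by
    rw [wHat, if_neg (not_le.mpr hn)]
    simp only [Matrix.mulVec_mulVec, Matrix.mul_assoc]
    rfl
  have hinner : ∀ (v : Vec d) (i : Fin n), inner ℝ v (x i) = (Xᵀ *ᵥ v.ofLp) i := by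
    intro v i
    rw [PiLp.inner_apply]
    simp [Matrix.mulVec, dotProduct, hX, dataMatrix]
  constructor
  · rw [hw]
    have : ∀ c : Fin n → ℝ, WithLp.toLp 2 (X *ᵥ c) = ∑ i, c i • x i := by
      intro c
      ext k
      simp [Matrix.mulVec, dotProduct, hX, dataMatrix, mul_comm]
    rw [this]
    exact Submodule.sum_mem _ fun i _ => Submodule.smul_mem _ _ (mem_dataSpan x i)
  · intro i
    rw [hinner, hinner, hw, Matrix.mulVec_mulVec, Matrix.mulVec_mulVec,
      Matrix.mul_nonsing_inv _ ((Matrix.isUnit_iff_isUnit_det _).mp hx), Matrix.one_mulVec]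

end Random

/-! ### Convergence of the end-to-end flow -/

section Convergence

variable {d n M : ℕ} {wstar : Vec d} {x : Fin n → Vec d}

/-- The dynamics of the end-to-end vector of a balanced network with `M + 1` layers: `w` is the
vector and `s = ‖w‖ ^ (2 / (M + 1))`. The velocity equation is multiplied by `s`. -/
structure EndToEndFlow (wstar : Vec d) (x : Fin n → Vec d) (M : ℕ) (w : ℝ → Vec d) (s : ℝ → ℝ)
    (D : ℝ → Vec d) : Prop where
  nonneg : ∀ t, 0 ≤ t → 0 ≤ s t
  pow_eq : ∀ t, 0 ≤ t → s t ^ (M + 1) = ‖w t‖ ^ 2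
  deriv_s : ∀ t, 0 ≤ t →
    HasDerivWithinAt s (-2 * inner ℝ (w t) (lossGrad wstar x (w t))) (Set.Ici 0) t
  deriv_w : ∀ t, 0 ≤ t → HasDerivWithinAt w (D t) (Set.Ici 0) t
  smul_velocity : ∀ t, 0 ≤ t → s t • D t = -(s t ^ (M + 1) • lossGrad wstar x (w t) +
    (M * inner ℝ (w t) (lossGrad wstar x (w t))) • w t)
  descent : ∀ t, 0 ≤ t → inner ℝ (lossGrad wstar x (w t)) (D t) ≤ (0 : ℝ)

lemma antitoneOn_Ici_of_hasDerivWithinAt {f f' : ℝ → ℝ}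
    (hf : ∀ t, 0 ≤ t → HasDerivWithinAt f (f' t) (Set.Ici 0) t) (hf' : ∀ t, 0 ≤ t → f' t ≤ 0) :
    AntitoneOn f (Set.Ici 0) := by
  refine antitoneOn_of_hasDerivWithinAt_nonpos (f' := f') (convex_Ici 0)
    (fun t ht => (hf t ht).continuousWithinAt) ?_ ?_
  · intro t ht
    exact (hf t (interior_subset ht)).mono interior_subset
  · intro t ht
    exact hf' t (interior_subset ht)

namespace EndToEndFlow

variable {w : ℝ → Vec d} {s : ℝ → ℝ} {D : ℝ → Vec d}

lemma hasDerivWithinAt_crossEntropy (h : EndToEndFlow wstar x M w s D) {t : ℝ} (ht : 0 ≤ t) :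
    HasDerivWithinAt (fun τ => crossEntropy wstar x (w τ))
      (inner ℝ (lossGrad wstar x (w t)) (D t)) (Set.Ici 0) t :=
  (hasFDerivAt_crossEntropy wstar x (w t)).comp_hasDerivWithinAt t (h.deriv_w t ht)

lemma antitoneOn_crossEntropy (h : EndToEndFlow wstar x M w s D) :
    AntitoneOn (fun τ => crossEntropy wstar x (w τ)) (Set.Ici 0) :=
  antitoneOn_Ici_of_hasDerivWithinAt (fun _ ht => h.hasDerivWithinAt_crossEntropy ht) h.descent

/-- As the initial loss is below the loss at `0` and the loss does not increase, the vector stays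
away from `0`. -/
lemma exists_lower_bound (h : EndToEndFlow wstar x M w s D)
    (h0 : crossEntropy wstar x (w 0) < crossEntropy wstar x 0) :
    ∃ c, 0 < c ∧ ∀ t, 0 ≤ t → c ≤ s t := by
  obtain ⟨δ, hδ, hball⟩ := Metric.eventually_nhds_iff.mp
    ((continuous_crossEntropy wstar x).continuousAt.eventually_const_lt h0)
  refine ⟨min 1 (δ ^ 2), lt_min one_pos (by positivity), fun t ht => ?_⟩
  by_contra! hlt
  have h1 : s t ≤ 1 := (hlt.trans_le (min_le_left _ _)).le
  have h2 : ‖w t‖ ^ 2 < δ ^ 2 := by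
    rw [← h.pow_eq t ht]
    exact (pow_le_of_le_one (h.nonneg t ht) h1 (by omega)).trans_lt
      (hlt.trans_le (min_le_right _ _))
  have h3 := hball (y := w t) (by
    rw [dist_zero_right]; exact lt_of_pow_lt_pow_left₀ 2 hδ.le h2)
  exact absurd (h.antitoneOn_crossEntropy (Set.mem_Ici.mpr le_rfl) ht ht) (not_le.mpr h3)

lemma descent_rate (h : EndToEndFlow wstar x M w s D) {t : ℝ} (ht : 0 ≤ t) (hs : 0 < s t) :
    inner ℝ (lossGrad wstar x (w t)) (D t) ≤ -(s t ^ M * ‖lossGrad wstar x (w t)‖ ^ 2) := by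
  set g := lossGrad wstar x (w t) with hg
  have h1 := congrArg (fun z => (inner ℝ g z : ℝ)) (h.smul_velocity t ht)
  simp only [← hg, inner_smul_right, inner_neg_right, inner_add_right,
    real_inner_self_eq_norm_sq, real_inner_comm (w t) g] at h1
  refine le_of_mul_le_mul_left ?_ hs
  have h2 : 0 ≤ (M : ℝ) * inner ℝ (w t) g ^ 2 := by positivity
  rw [h1, pow_succ]
  linarith

/-- The loss falls below every level above its minimum: otherwise its gradient would be
bounded away from `0` along the flow, and the loss would tend to `-∞`. -/
lemma exists_crossEntropy_lt (h : EndToEndFlow wstar x M w s D) (hn : 0 < n)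
    (h0 : crossEntropy wstar x (w 0) < crossEntropy wstar x 0) {what : Vec d}
    (hmem : what ∈ dataSpan x) (hwhat : ∀ i, inner ℝ what (x i) = (inner ℝ wstar (x i) : ℝ))
    {c : ℝ} (hc : crossEntropy wstar x what < c) :
    ∃ t, 0 ≤ t ∧ crossEntropy wstar x (w t) < c := by
  by_contra! hge
  set L := crossEntropy wstar x with hL
  set K := {v : Vec d | v ∈ dataSpan x ∧ L v ≤ L (w 0)} ∩ {v | c ≤ L v} with hK
  have hKc : IsCompact K := (isCompact_sublevel hn _).inter_right
    (isClosed_le continuous_const (continuous_crossEntropy wstar x))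
  have hmemK : ∀ t, 0 ≤ t → (dataSpan x).starProjection (w t) ∈ K := by
    intro t ht
    refine ⟨⟨Submodule.starProjection_apply_mem _ _, ?_⟩, ?_⟩
    · rw [hL, crossEntropy_starProjection]
      exact h.antitoneOn_crossEntropy (Set.mem_Ici.mpr le_rfl) ht ht
    · rw [Set.mem_ofPred_eq, hL, crossEntropy_starProjection]
      exact hge t ht
  obtain ⟨u, hu, humin⟩ := hKc.exists_isMinOn ⟨_, hmemK 0 le_rfl⟩
    (continuous_lossGrad wstar x).norm.continuousOn
  have hupos : 0 < ‖lossGrad wstar x u‖ := by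
    refine norm_pos_iff.mpr (lossGrad_ne_zero hn hmem hwhat hu.1.1 ?_)
    rintro rfl
    exact absurd hu.2 (not_le.mpr hc)
  obtain ⟨σ, hσ, hσs⟩ := h.exists_lower_bound h0
  set r := σ ^ M * ‖lossGrad wstar x u‖ ^ 2 with hr
  have hrpos : 0 < r := by positivity
  have hanti : AntitoneOn (fun t => L (w t) + r * t) (Set.Ici 0) := by
    refine antitoneOn_Ici_of_hasDerivWithinAt
      (f' := fun t => inner ℝ (lossGrad wstar x (w t)) (D t) + r) (fun t ht => ?_) fun t ht => ?_
    · exact ((h.hasDerivWithinAt_crossEntropy ht).add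
        ((hasDerivWithinAt_id t (Set.Ici 0)).const_mul r)).congr_deriv (by rw [mul_one])
    · have h1 := h.descent_rate ht (hσ.trans_le (hσs t ht))
      have h2 : ‖lossGrad wstar x u‖ ≤ ‖lossGrad wstar x (w t)‖ := by
        rw [← lossGrad_starProjection (w t)]; exact humin (hmemK t ht)
      have h3 : r ≤ s t ^ M * ‖lossGrad wstar x (w t)‖ ^ 2 := by
        rw [hr]
        exact mul_le_mul (pow_le_pow_left₀ hσ.le (hσs t ht) M)
          (pow_le_pow_left₀ (norm_nonneg _) h2 2) (sq_nonneg _) (pow_nonneg (h.nonneg t ht) M)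
      linarith
  -- At this time the linear decrease has used up the whole gap between `L (w 0)` and `c`.
  set T := (L (w 0) - c) / r + 1 with hT
  have hT0 : 0 ≤ T := by
    have := div_nonneg (sub_nonneg.mpr (hge 0 le_rfl)) hrpos.le
    linarith
  have h1 := hanti (Set.mem_Ici.mpr le_rfl) hT0 hT0
  have h2 : r * T = L (w 0) - c + r := by rw [hT]; field_simp
  have h3 := hge T hT0
  simp only [mul_zero, add_zero] at h1
  linarith

/-- The component of the vector in the span of the data converges to the minimizer. -/
lemma tendsto_starProjection (h : EndToEndFlow wstar x M w s D) (hn : 0 < n)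
    (h0 : crossEntropy wstar x (w 0) < crossEntropy wstar x 0) {what : Vec d}
    (hmem : what ∈ dataSpan x) (hwhat : ∀ i, inner ℝ what (x i) = (inner ℝ wstar (x i) : ℝ)) :
    Tendsto (fun t => (dataSpan x).starProjection (w t)) atTop (𝓝 what) := by
  set L := crossEntropy wstar x with hL
  rw [(nhds_basis_opens what).tendsto_right_iff]
  rintro U ⟨hwU, hU⟩
  -- Outside of `U` the loss exceeds its minimum by a fixed amount.
  obtain ⟨c, hc, hcU⟩ : ∃ c, L what < c ∧
      ∀ v ∈ dataSpan x, L v ≤ L (w 0) → v ∉ U → c ≤ L v := by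
    have hKc : IsCompact ({v : Vec d | v ∈ dataSpan x ∧ L v ≤ L (w 0)} \ U) :=
      (isCompact_sublevel hn _).diff hU
    rcases Set.eq_empty_or_nonempty ({v : Vec d | v ∈ dataSpan x ∧ L v ≤ L (w 0)} \ U) with he | he
    · exact ⟨L what + 1, by linarith, fun v h1 h2 h3 =>
        absurd ⟨⟨h1, h2⟩, h3⟩ (Set.eq_empty_iff_forall_notMem.mp he v)⟩
    · obtain ⟨u, hu, humin⟩ := hKc.exists_isMinOn he (continuous_crossEntropy wstar x).continuousOn
      exact ⟨L u, crossEntropy_lt_of_ne hn hmem hwhat hu.1.1 fun e => hu.2 (e ▸ hwU),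
        fun v h1 h2 h3 => humin ⟨⟨h1, h2⟩, h3⟩⟩
  obtain ⟨T, hT0, hT⟩ := h.exists_crossEntropy_lt hn h0 hmem hwhat hc
  filter_upwards [eventually_ge_atTop T] with t ht
  by_contra hnot
  have ht0 : 0 ≤ t := hT0.trans ht
  have h1 := hcU _ (Submodule.starProjection_apply_mem _ (w t)) (by
    rw [hL, crossEntropy_starProjection]
    exact h.antitoneOn_crossEntropy (Set.mem_Ici.mpr le_rfl) ht0 ht0) hnot
  rw [hL, crossEntropy_starProjection] at h1
  exact absurd (h1.trans (h.antitoneOn_crossEntropy hT0 ht0 ht)) (not_le.mpr hT)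

/-- The component `q` of the vector orthogonal to the data keeps its direction, and its size is
tied to that of the vector: `‖q‖² / s ^ M` is conserved. -/
lemma norm_sq_orthogonal_eq (h : EndToEndFlow wstar x M w s D) (hs : ∀ t, 0 ≤ t → 0 < s t)
    {t : ℝ} (ht : 0 ≤ t) :
    ‖(dataSpan x)ᗮ.starProjection (w t)‖ ^ 2 / s t ^ M =
      ‖(dataSpan x)ᗮ.starProjection (w 0)‖ ^ 2 / s 0 ^ M := by
  set Q := (dataSpan x)ᗮ.starProjection with hQ
  refine eqOn_Ici_of_hasDerivWithinAt_zero (f := fun t => ‖Q (w t)‖ ^ 2 / s t ^ M) ?_ ht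
  intro t ht
  have h1 : HasDerivWithinAt (fun τ => Q (w τ)) (Q (D t)) (Set.Ici 0) t :=
    Q.hasFDerivAt.comp_hasDerivWithinAt t (h.deriv_w t ht)
  have h2 := h1.norm_sq
  have h3 := (h.deriv_s t ht).fun_pow M
  have hst := hs t ht
  refine (h2.fun_div h3 (pow_pos hst M).ne').congr_deriv ?_
  set g := lossGrad wstar x (w t) with hg
  have hQg : Q g = 0 := by
    rw [hQ, Submodule.starProjection_apply_eq_zero_iff, Submodule.orthogonal_orthogonal]
    exact lossGrad_mem_dataSpan (w t)
  have h4 := congrArg (fun z => (inner ℝ (Q (w t)) (Q z) : ℝ)) (h.smul_velocity t ht)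
  simp only [map_smul, map_neg, map_add, ← hg, hQg, smul_zero, zero_add, inner_smul_right,
    inner_neg_right, real_inner_self_eq_norm_sq] at h4
  rw [div_eq_zero_iff]
  left
  rcases M with _ | m
  · have h5 : inner ℝ (Q (w t)) (Q (D t)) = (0 : ℝ) := by
      have : s t * inner ℝ (Q (w t)) (Q (D t)) = (0 : ℝ) := by rw [h4]; simp
      exact (mul_eq_zero.mp this).resolve_left hst.ne'
    simp [h5]
  · rw [Nat.add_sub_cancel, pow_succ]
    linear_combination (2 * s t ^ m) * h4

/-- The final estimate: the orthogonal component is eventually controlled by its initial size,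
through `‖q‖² (s - C) = C ‖v‖²` with `C = ‖q‖² / s ^ M` and `s ≥ ‖v‖ ^ (2 / (M + 1))`. -/
lemma eventually_norm_sub_le (h : EndToEndFlow wstar x M w s D) (hn : 0 < n)
    (h0 : crossEntropy wstar x (w 0) < crossEntropy wstar x 0) {what : Vec d}
    (hmem : what ∈ dataSpan x) (hwhat : ∀ i, inner ℝ what (x i) = (inner ℝ wstar (x i) : ℝ))
    {ε b : ℝ} (hε : 0 < ε) (hbpow : b ^ (M + 1) = ‖what‖ ^ 2)
    (hinit : s 0 * (ε ^ 2 + ‖what‖ ^ 2) < ε ^ 2 * b) :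
    ∀ᶠ t in atTop, ‖w t - what‖ ≤ ε := by
  obtain ⟨c, hc, hcs⟩ := h.exists_lower_bound h0
  have hs : ∀ t, 0 ≤ t → 0 < s t := fun t ht => hc.trans_le (hcs t ht)
  set V := (dataSpan x).starProjection with hV
  set Q := (dataSpan x)ᗮ.starProjection with hQ
  have hsplit : ∀ z, ‖z‖ ^ 2 = ‖V z‖ ^ 2 + ‖Q z‖ ^ 2 := fun z =>
    Submodule.norm_sq_eq_add_norm_sq_starProjection z (dataSpan x)
  set C := ‖Q (w 0)‖ ^ 2 / s 0 ^ M with hC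
  have hC0 : 0 ≤ C := div_nonneg (sq_nonneg _) (pow_nonneg (h.nonneg 0 le_rfl) M)
  have hCs : C ≤ s 0 := by
    rw [hC, div_le_iff₀ (pow_pos (hs 0 le_rfl) M), ← pow_succ', h.pow_eq 0 le_rfl, hsplit (w 0)]
    linarith [sq_nonneg ‖V (w 0)‖]
  have hCb : C * (ε ^ 2 + ‖what‖ ^ 2) < ε ^ 2 * b :=
    (mul_le_mul_of_nonneg_right hCs (by positivity)).trans_lt hinit
  have hv := h.tendsto_starProjection hn h0 hmem hwhat
  have hvn : Tendsto (fun t => ‖V (w t)‖ ^ 2) atTop (𝓝 (‖what‖ ^ 2)) := (hv.norm).pow 2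
  have hvd : Tendsto (fun t => ‖V (w t) - what‖ ^ 2) atTop (𝓝 0) := by
    simpa using ((hv.sub_const what).norm).pow 2
  -- Any `β < b` is an eventual lower bound of `s`; continuity leaves room for the strict
  -- inequality `C * (ε² + ‖what‖²) < ε² * β`.
  obtain ⟨β, hβ0, hβb, hCβ⟩ : ∃ β, 0 ≤ β ∧ β < b ∧ C * (ε ^ 2 + ‖what‖ ^ 2) < ε ^ 2 * β := by
    have hlt : C * (ε ^ 2 + ‖what‖ ^ 2) / ε ^ 2 < b := by
      rw [div_lt_iff₀ (by positivity)]; linarith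
    obtain ⟨β, h1, h2⟩ := exists_between hlt
    refine ⟨β, le_trans (by positivity) h1.le, h2, ?_⟩
    rw [div_lt_iff₀ (by positivity)] at h1
    linarith
  have hβpow : β ^ (M + 1) < ‖what‖ ^ 2 := by
    rw [← hbpow]; exact pow_lt_pow_left₀ hβb hβ0 (by omega)
  have hCβ' : C < β := by
    have : C * ε ^ 2 ≤ C * (ε ^ 2 + ‖what‖ ^ 2) := by gcongr; linarith [sq_nonneg ‖what‖]
    have h2 : ε ^ 2 * C < ε ^ 2 * β := by linarith
    exact lt_of_mul_lt_mul_left h2 (by positivity)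
  have hlim : Tendsto (fun t => ‖V (w t) - what‖ ^ 2 * (β - C) + C * ‖V (w t)‖ ^ 2) atTop
      (𝓝 (0 * (β - C) + C * ‖what‖ ^ 2)) := (hvd.mul_const _).add (hvn.const_mul C)
  have hev := hlim.eventually_lt_const (u := ε ^ 2 * (β - C)) (by linarith)
  filter_upwards [hev, hvn.eventually_const_lt hβpow, eventually_ge_atTop 0] with t h1 h2 ht
  have hq : ‖Q (w t)‖ ^ 2 = C * s t ^ M := by
    have := h.norm_sq_orthogonal_eq hs ht
    rwa [div_eq_iff (pow_pos (hs t ht) M).ne'] at this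
  have hpow := h.pow_eq t ht
  rw [hsplit (w t)] at hpow
  have hβs : β ≤ s t := by
    refine le_of_lt (lt_of_pow_lt_pow_left₀ (M + 1) (h.nonneg t ht) ?_)
    rw [hpow]
    linarith [sq_nonneg ‖Q (w t)‖]
  have hkey : ‖Q (w t)‖ ^ 2 * (s t - C) = C * ‖V (w t)‖ ^ 2 := by
    rw [pow_succ] at hpow
    linear_combination s t * hq + C * hpow
  have hkey2 : ‖Q (w t)‖ ^ 2 * (β - C) ≤ C * ‖V (w t)‖ ^ 2 := by
    rw [← hkey]; gcongr
  have hVwhat : V what = what := Submodule.starProjection_eq_self_iff.mpr hmem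
  have hQwhat : Q what = 0 := by
    rw [hQ, Submodule.starProjection_apply_eq_zero_iff, Submodule.orthogonal_orthogonal]
    exact hmem
  have hdist : ‖w t - what‖ ^ 2 = ‖V (w t) - what‖ ^ 2 + ‖Q (w t)‖ ^ 2 := by
    rw [hsplit, map_sub, map_sub, hVwhat, hQwhat, sub_zero]
  refine le_of_sq_le_sq ?_ hε.le
  refine le_of_mul_le_mul_right (a := β - C) ?_ (by linarith)
  rw [hdist, add_mul]
  linarith

end EndToEndFlow

/-- A balanced gradient flow of a deep linear network induces an `EndToEndFlow`. -/
lemma exists_endToEndFlow {A : Architecture d (M + 1)} {W : ℝ → Weights A}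
    (hW : IsGradientFlow wstar x W) (hb : Balanced (W 0)) :
    ∃ s D, EndToEndFlow wstar x M (fun t => endToEnd (W t)) s D := by
  obtain ⟨s, hs⟩ := exists_endToEnd_dynamics wstar x hW hb
  choose! h1 h2 h3 D h4 h5 h6 using hs
  exact ⟨s, D, h1, h2, h3, h4, h5, h6⟩

/-- The smallness condition on the initial norm, in terms of `s = ‖w‖ ^ (2 / N)` and
`b = a ^ (2 / N)`, where `a` is the norm of the target. -/
lemma init_bound {N : ℕ} (hN : 0 < N) {r s a ε : ℝ} (ha : 0 < a) (hε : 0 < ε) (hr : 0 ≤ r)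
    (hsr : s ^ N = r ^ 2)
    (h : r < ε ^ N * (ε ^ 2 * a ^ (-(2 / (N : ℝ))) + a ^ (2 - 2 / (N : ℝ))) ^ (-((N : ℝ) / 2))) :
    s * (ε ^ 2 + a ^ 2) < ε ^ 2 * a ^ (2 / (N : ℝ)) := by
  have hN' : (0 : ℝ) < N := by exact_mod_cast hN
  set b := a ^ (2 / (N : ℝ)) with hb
  have hb0 : 0 < b := Real.rpow_pos_of_pos ha _
  have hE : ε ^ 2 * a ^ (-(2 / (N : ℝ))) + a ^ (2 - 2 / (N : ℝ)) = (ε ^ 2 + a ^ 2) / b := by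
    rw [Real.rpow_neg ha.le, Real.rpow_sub ha, Real.rpow_two, ← hb]
    field_simp
  rw [hE] at h
  set y := (ε ^ 2 + a ^ 2) / b with hy
  have hy0 : 0 < y := by positivity
  have h1 : (ε ^ N * y ^ (-((N : ℝ) / 2))) ^ 2 = (ε ^ 2 / y) ^ N := by
    rw [mul_pow, ← Real.rpow_natCast (y ^ _) 2, ← Real.rpow_mul hy0.le,
      show -((N : ℝ) / 2) * ((2 : ℕ) : ℝ) = -(N : ℝ) by push_cast; ring, Real.rpow_neg hy0.le,
      Real.rpow_natCast, div_pow _ y, ← pow_mul, ← pow_mul, mul_comm N 2, div_eq_mul_inv]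
  have h2 : s ^ N < (ε ^ 2 / y) ^ N := by
    rw [hsr, ← h1]
    exact pow_lt_pow_left₀ h hr two_ne_zero
  have h3 : s < ε ^ 2 / y := lt_of_pow_lt_pow_left₀ N (by positivity) h2
  rw [lt_div_iff₀ hy0, hy, ← mul_div_assoc, div_lt_iff₀ hb0] at h3
  exact h3

end Convergence

end LinearDistillation

theorem theorem2 (d n N : ℕ) (hN : 2 ≤ N) (A : LinearDistillation.Architecture d N)
    (P : Measure (LinearDistillation.Vec d)) [IsProbabilityMeasure P]
    (p : LinearDistillation.Vec d → ℝ≥0∞) (hp : Measurable p) (hP : P = volume.withDensity p)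
    (wstar : LinearDistillation.Vec d) (hwstar : wstar ≠ 0) :
    (d ≤ n →
      ∀ᵐ x ∂(Measure.pi fun _ : Fin n => P),
        ∀ ε : ℝ, 0 < ε → ∀ W : ℝ → LinearDistillation.Weights A,
          LinearDistillation.IsGradientFlow wstar x W →
          LinearDistillation.GoodInit wstar x ε (W 0) →
          Tendsto (fun t => LinearDistillation.endToEnd (W t)) atTop
            (𝓝 (LinearDistillation.wHat wstar x))) ∧
    (n < d →
      (∀ᵐ x ∂(Measure.pi fun _ : Fin n => P),
        IsUnit ((LinearDistillation.dataMatrix x)ᵀ * LinearDistillation.dataMatrix x)) ∧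
      ∀ x : Fin n → LinearDistillation.Vec d,
        IsUnit ((LinearDistillation.dataMatrix x)ᵀ * LinearDistillation.dataMatrix x) →
        ∀ ε : ℝ, 0 < ε → ∀ W : ℝ → LinearDistillation.Weights A,
          LinearDistillation.IsGradientFlow wstar x W →
          LinearDistillation.GoodInit wstar x ε (W 0) →
          ∀ᶠ t in atTop,
            ‖LinearDistillation.endToEnd (W t) - LinearDistillation.wHat wstar x‖ ≤ ε) := by
  open LinearDistillation in
  have hPv : P ≪ volume := hP ▸ withDensity_absolutelyContinuous volume p
  obtain ⟨M, rfl⟩ : ∃ M, N = M + 1 := ⟨N - 1, by omega⟩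
  refine ⟨fun hdn => ?_, fun hnd => ⟨ae_isUnit_gram P hPv hnd, fun x hx ε hε W hW hinit => ?_⟩⟩
  · filter_upwards [ae_dataSpan_eq_top P hPv hdn] with x hx ε hε W hW hinit
    -- The space is nontrivial, so there is at least one input.
    have hn : 0 < n := by
      rcases Nat.eq_zero_or_pos n with rfl | hn
      · obtain rfl : d = 0 := by omega
        exact absurd (Subsingleton.elim _ _) hwstar
      · exact hn
    obtain ⟨s, D, hflow⟩ := exists_endToEndFlow hW hinit.balanced
    have h0 := (sub_lt_sub_iff_right _).mp hinit.better_than_zero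
    have h := hflow.tendsto_starProjection hn h0 (what := wstar) (hx ▸ Submodule.mem_top)
      fun _ => rfl
    simpa only [hx, Submodule.starProjection_top, ContinuousLinearMap.id_apply, wHat, if_pos hdn]
      using h
  · obtain ⟨hmem, hwhat⟩ := wHat_mem_dataSpan_and_inner (wstar := wstar) hnd hx
    have hlt := lt_min_iff.mp hinit.near_zero
    have ha : 0 < ‖wHat wstar x‖ := (norm_nonneg _).trans_lt hlt.1
    have hn : 0 < n := by
      rcases Nat.eq_zero_or_pos n with rfl | hn
      · have h1 : wHat wstar x = 0 := by simpa [dataSpan] using hmem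
        rw [h1, norm_zero] at ha
        exact absurd ha (lt_irrefl _)
      · exact hn
    obtain ⟨s, D, hflow⟩ := exists_endToEndFlow hW hinit.balanced
    have h0 := (sub_lt_sub_iff_right _).mp hinit.better_than_zero
    refine hflow.eventually_norm_sub_le hn h0 hmem hwhat hε ?_
      (init_bound (Nat.succ_pos M) ha hε (norm_nonneg _)
        (hflow.pow_eq 0 le_rfl) hlt.2)
    rw [← Real.rpow_natCast, ← Real.rpow_mul ha.le, div_mul_cancel₀ _ (by positivity),
      Real.rpow_two]
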